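/- Let $\mathbb T$ be the unit circle with normalized Lebesgue measure, $L^2=L^2(\mathbb T)$, $H^2\subset L^2$ the Hardy space, and let $u$ be a nonconstant inner function. Let $K_u=H^2\ominus uH^2$, and let $P_u$ be the orthogonal projection of $L^2$ onto $K_u$. For $\Phi\in L^2$, the truncated Toeplitz operator with symbol $\Phi$ is $A_\Phi f=P_u(\Phi f)$, defined for the bounded functions $f\in K_u$; let $\mathcal T_u$ be the set of all bounded operators on $K_u$ that extend some $A_\Phi$, $\Phi\in L^2$ (such a $\Phi$ is called a symbol of the operator). Let $Cf=u\,\overline{zf}$ be the canonical conjugation on $K_u$ and $S_uf=P_u(zf)$ the compressed shift on $K_u$. For $\alpha\in\mathbb C$, let $\mathcal B_\alpha$ be the set of all operators in $\mathcal T_u$ that have a symbol of the form $\varphi+\alpha\,\overline{S_uC\varphi}+c$ with $\varphi\in K_u$, $c\in\mathbb C$; let $\mathcal B_\infty$ be the set of all operators in $\mathcal T_u$ that have an antiholomorphic symbol $\overline\psi$, $\psi\in H^2$. Theorem. (1) For every $\alpha\in\mathbb C\cup\{\infty\}$, $\mathcal B_\alpha$ is a commutative unital algebra of bounded operators on $K_u$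 that is closed in the weak operator topology and contained in $\mathcal T_u$. (2) Let $\mathcal A$ be an algebra (of bounded operators on $K_u$, unital or not) contained in $\mathcal T_u$. Then there exists $\alpha\in\mathbb C\cup\{\infty\}$ such that $\mathcal A\subseteq\mathcal B_\alpha$. (3) Consequently the algebras $\mathcal B_\alpha$ are exactly the maximal algebras contained in $\mathcal T_u$: an algebra $\mathcal A\subseteq\mathcal T_u$ is maximal with respect to inclusion among the algebras contained in $\mathcal T_u$ if and only if $\mathcal A=\mathcal B_\alpha$ for some $\alpha\in\mathbb C\cup\{\infty\}$. -/

import Mathlib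

open MeasureTheory AddCircle

noncomputable section

namespace TTO

/-! The unit circle is parametrized by `t ↦ exp (2 π i t)`, `t ∈ ℝ / ℤ`; the normalized Lebesgue
measure on the circle is then `haarAddCircle`, and the function `z ^ n` is `fourier n`. -/

/-- `L²` of the unit circle with normalized Lebesgue measure. -/
abbrev L2 : Type := Lp ℂ 2 (haarAddCircle : Measure UnitAddCircle)

/-- `L^∞` of the unit circle. -/
abbrev Linf : Type := Lp ℂ ⊤ (haarAddCircle : Measure UnitAddCircle)

/-- The coordinate function `z` on the circle, as an element of `L^∞`. -/
def z : Linf := fourierLp ⊤ 1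

lemma coeff_eq_inner (n : ℤ) (f : L2) :
    fourierCoeff (f : UnitAddCircle → ℂ) n = inner ℂ (fourierLp 2 n : L2) f := by
  rw [← fourierBasis_repr, HilbertBasis.repr_apply_apply, coe_fourierBasis]

/-- The Hardy space `H²`: all `f ∈ L²` whose negatively indexed Fourier coefficients vanish. -/
def H2 : Submodule ℂ L2 where
  carrier := {f | ∀ n : ℤ, n < 0 → fourierCoeff (f : UnitAddCircle → ℂ) n = 0}
  zero_mem' := by
    intro n _
    rw [coeff_eq_inner, inner_zero_right]
  add_mem' := by
    intro f g hf hg n hn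
    have h1 := hf n hn
    have h2 := hg n hn
    rw [coeff_eq_inner] at h1 h2 ⊢
    rw [inner_add_right, h1, h2, add_zero]
  smul_mem' := by
    intro c f hf n hn
    have h1 := hf n hn
    rw [coeff_eq_inner] at h1 ⊢
    rw [inner_smul_right, h1, mul_zero]

lemma isClosed_H2 : IsClosed (H2 : Set L2) := by
  have h : (H2 : Set L2) =
      ⋂ n : ℤ, ⋂ _ : n < 0, {f : L2 | inner ℂ (fourierLp 2 n : L2) f = 0} := by
    ext f
    simp only [Set.mem_iInter, Set.mem_ofPred_eq, ← coeff_eq_inner]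
    rfl
  rw [h]
  exact isClosed_iInter fun n => isClosed_iInter fun _ =>
    isClosed_eq (continuous_const.inner continuous_id) continuous_const

/-- Inner functions, through their boundary values: `u` is in `H^∞` and unimodular a.e. -/
structure IsInner (u : Linf) : Prop where
  coeff_eq_zero : ∀ n : ℤ, n < 0 → fourierCoeff (u : UnitAddCircle → ℂ) n = 0
  norm_eq_one : ∀ᵐ t ∂(haarAddCircle : Measure UnitAddCircle), ‖u t‖ = 1

/-- `u` is (a.e. equal to) a constant function. -/
def IsConstant (u : Linf) : Prop :=
  ∃ c : ℂ, ∀ᵐ t ∂(haarAddCircle : Measure UnitAddCircle), u t = c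

/-- The subspace `u H² = {u h : h ∈ H²}` of `L²`. -/
def uH2 (u : Linf) : Submodule ℂ L2 where
  carrier := {g | ∃ h ∈ H2, g = (u • h : L2)}
  zero_mem' := ⟨0, H2.zero_mem, (Lp.smul_zero ℂ 2 u).symm⟩
  add_mem' := by
    rintro _ _ ⟨h, hh, rfl⟩ ⟨k, hk, rfl⟩
    exact ⟨h + k, H2.add_mem hh hk, (Lp.add_smul u h k).symm⟩
  smul_mem' := by
    rintro c _ ⟨h, hh, rfl⟩
    exact ⟨c • h, H2.smul_mem c hh, Lp.smul_comm c u h⟩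

/-- The model space `K_u = H² ⊖ u H²`. -/
def modelSpace (u : Linf) : Submodule ℂ L2 := H2 ⊓ (uH2 u)ᗮ

instance (u : Linf) : CompleteSpace (modelSpace u) := by
  have h : IsClosed (modelSpace u : Set L2) :=
    isClosed_H2.inter (Submodule.isClosed_orthogonal (uH2 u))
  exact h.completeSpace_coe

/-- The orthogonal projection `P_u` of `L²` onto `K_u`. -/
def P (u : Linf) : L2 →L[ℂ] modelSpace u := (modelSpace u).orthogonalProjectionOnto

/-- The bounded operators on `K_u`. -/
abbrev Op (u : Linf) : Type := modelSpace u →L[ℂ] modelSpace u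

/-- `Φ ∈ L²` is a symbol of the bounded operator `A` on `K_u`, that is, `A` extends the truncated
Toeplitz operator `f ↦ P_u (Φ f)`, defined for the bounded functions `f` in `K_u`. Here `g` is the
function `f`, seen as an element of `L^∞`. -/
def HasSymbol (u : Linf) (A : Op u) (Φ : L2) : Prop :=
  ∀ (f : modelSpace u) (g : Linf),
    (g : UnitAddCircle → ℂ) =ᵐ[haarAddCircle] ((f : L2) : UnitAddCircle → ℂ) →
      A f = P u (g • Φ : L2)

/-- The set of all bounded truncated Toeplitz operators on `K_u`. -/
def boundedTTO (u : Linf) : Set (Op u) := {A | ∃ Φ : L2, HasSymbol u A Φ}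

/-- The conjugation `C f = u * conj (z f)`; it maps `K_u` to itself when `u` is inner. -/
def C (u : Linf) (f : L2) : L2 := u • star (z • f : L2)

/-- `S_u C φ`, where `S_u f = P_u (z f)` is the compressed shift on `K_u`. -/
def SC (u : Linf) (φ : modelSpace u) : modelSpace u := P u (z • C u φ : L2)

/-- The set `B_α`, `α` in the Riemann sphere, of all bounded truncated Toeplitz operators on `K_u`
of type `α`: those with a symbol `φ + α * conj (S_u C φ) + c`, where `φ ∈ K_u` and `c ∈ ℂ`, if
`α ∈ ℂ`, and those with an antiholomorphic symbol if `α = ∞`. -/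
def typeSet (u : Linf) : OnePoint ℂ → Set (Op u)
  | OnePoint.infty => {A | ∃ ψ ∈ H2, HasSymbol u A (star ψ)}
  | OnePoint.some α => {A | ∃ (φ : modelSpace u) (c : ℂ),
      HasSymbol u A ((φ : L2) + α • star (SC u φ : L2) + Lp.const 2 haarAddCircle c)}

end TTO

end

/-!
Write `k` for the reproducing kernel of the model space at `0`, `S` for the compressed shift, `R`
for its adjoint and `J` for `S C`. By Sarason's theorem, a bounded operator `T` is a truncated
Toeplitz operator if and only if `T - S T R` is of the form `a ⊗ k + k ⊗ a'`, and then
`a + conj a'` is a symbol of `T`. If `A` and `B` correspond to `(a, a')` and `(b, b')`, then up to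
summands `k ⊗ x` and `x ⊗ k` the operator `A B - S A B R` is `a ⊗ b' - J a' ⊗ J b`. Hence `A B` is a
truncated Toeplitz operator if and only if this expression vanishes up to such summands. For `A = B`
this forces `a` and `J a'` to be proportional modulo `k`, in the ratio `α` that determines the class
`B_α`, and in general it forces the ratios of `A` and `B` to agree unless one of them is scalar.

Every truncated Toeplitz operator is `C`-symmetric, so two of them commute as soon as their product
is one. Finally, `B_α` consists of the truncated Toeplitz operators that commute with a rank-one
perturbation of (a multiple of) `S` which itself lies in `B_α`. This makes `B_α` weakly closed and,
since every `B_β` is commutative, maximal.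
-/

noncomputable section

namespace TTO

open scoped ComplexConjugate InnerProductSpace
open Filter Topology

section Multiplication

variable {Ω : Type*} [MeasurableSpace Ω] {μ : Measure Ω}

lemma ae_smul {p : ENNReal} (a : Lp ℂ ⊤ μ) (x : Lp ℂ p μ) :
    ∀ᵐ t ∂μ, (a • x : Lp ℂ p μ) t = a t * x t :=
  Lp.coeFn_lpSMul (r := p) a x

lemma ae_star {p : ENNReal} (x : Lp ℂ p μ) : ∀ᵐ t ∂μ, (star x : Lp ℂ p μ) t = conj (x t) :=
  Lp.coeFn_star x

lemma star_add_Lp {p : ENNReal} (x y : Lp ℂ p μ) : star (x + y) = star x + star y := by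
  refine Lp.ext ?_
  filter_upwards [ae_star (x + y), ae_star x, ae_star y, Lp.coeFn_add x y,
    Lp.coeFn_add (star x) (star y)] with t h_star hx hy h_add h_add'
  rw [h_star, h_add', h_add, Pi.add_apply, Pi.add_apply, hx, hy, map_add]

lemma star_smul_Lp {p : ENNReal} (c : ℂ) (x : Lp ℂ p μ) : star (c • x) = conj c • star x := by
  refine Lp.ext ?_
  filter_upwards [ae_star (c • x), ae_star x, Lp.coeFn_smul c x,
    Lp.coeFn_smul (conj c) (star x)] with t h_star hx h_smul h_smul'
  rw [h_star, h_smul', h_smul, Pi.smul_apply, Pi.smul_apply, hx, smul_eq_mul, smul_eq_mul, map_mul]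

/-- Multiplication of `L²` functions by bounded functions. -/
def M : Lp ℂ ⊤ μ →L[ℂ] Lp ℂ 2 μ →L[ℂ] Lp ℂ 2 μ := (ContinuousLinearMap.lsmul ℂ ℂ).holderL μ ⊤ 2 2

lemma M_apply (a : Lp ℂ ⊤ μ) (x : Lp ℂ 2 μ) : M a x = (a • x : Lp ℂ 2 μ) := rfl

lemma ae_M (a : Lp ℂ ⊤ μ) (x : Lp ℂ 2 μ) : ∀ᵐ t ∂μ, M a x t = a t * x t := ae_smul a x

lemma inner_congr_ae {x y x' y' : Lp ℂ 2 μ}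
    (h : ∀ᵐ t ∂μ, conj (x t) * y t = conj (x' t) * y' t) : ⟪x, y⟫_ℂ = ⟪x', y'⟫_ℂ := by
  rw [L2.inner_def, L2.inner_def]
  refine integral_congr_ae ?_
  filter_upwards [h] with t ht
  simpa only [RCLike.inner_apply'] using ht

lemma inner_M_left (a : Lp ℂ ⊤ μ) (x y : Lp ℂ 2 μ) : ⟪M a x, y⟫_ℂ = ⟪x, M (star a) y⟫_ℂ := by
  refine inner_congr_ae ?_
  filter_upwards [ae_M a x, ae_M (star a) y, ae_star a] with t hx hy ha
  rw [hx, hy, ha, map_mul]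
  ring

lemma M_smul (a b : Lp ℂ ⊤ μ) (x : Lp ℂ 2 μ) : M (a • b : Lp ℂ ⊤ μ) x = M a (M b x) := by
  refine Lp.ext ?_
  filter_upwards [ae_M a (M b x), ae_M b x, ae_M (a • b : Lp ℂ ⊤ μ) x, ae_smul a b]
    with t h_left h_right h_M h_smul
  rw [h_left, h_right, h_M, h_smul, mul_assoc]

lemma M_comm (a b : Lp ℂ ⊤ μ) (x : Lp ℂ 2 μ) : M a (M b x) = M b (M a x) := by
  refine Lp.ext ?_
  filter_upwards [ae_M a (M b x), ae_M b x, ae_M b (M a x), ae_M a x] with t hab hb hba ha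
  rw [hab, hb, hba, ha, mul_left_comm]

lemma M_star_M {a : Lp ℂ ⊤ μ} (ha : ∀ᵐ t ∂μ, ‖a t‖ = 1) (x : Lp ℂ 2 μ) :
    M (star a) (M a x) = x := by
  refine Lp.ext ?_
  filter_upwards [ae_M (star a) (M a x), ae_M a x, ae_star a, ha] with t h_M hx h_star h_norm
  rw [h_M, hx, h_star, ← mul_assoc, Complex.conj_mul', h_norm, Complex.ofReal_one, one_pow, one_mul]

lemma M_M_star {a : Lp ℂ ⊤ μ} (ha : ∀ᵐ t ∂μ, ‖a t‖ = 1) (x : Lp ℂ 2 μ) :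
    M a (M (star a) x) = x := by
  rw [M_comm, M_star_M ha]

lemma star_M (a : Lp ℂ ⊤ μ) (x : Lp ℂ 2 μ) : star (M a x) = M (star a) (star x) := by
  refine Lp.ext ?_
  filter_upwards [ae_star (M a x), ae_M a x, ae_M (star a) (star x), ae_star a, ae_star x]
    with t h_star h_M h_M' ha hx
  rw [h_star, h_M, h_M', ha, hx, map_mul]

lemma inner_star_star (x y : Lp ℂ 2 μ) : ⟪star x, star y⟫_ℂ = ⟪y, x⟫_ℂ := by
  refine inner_congr_ae ?_
  filter_upwards [ae_star x, ae_star y] with t hx hy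
  rw [hx, hy, Complex.conj_conj, mul_comm]

end Multiplication

section Fourier

/-- The function `z ^ n`, as an element of `L^∞`. -/
abbrev zPow (n : ℤ) : Linf := fourierLp ⊤ n

/-- The function `z ^ n`, as an element of `L²`. -/
abbrev e (n : ℤ) : L2 := fourierLp 2 n

lemma star_fourierLp (p : ENNReal) [Fact (1 ≤ p)] (n : ℤ) :
    star (fourierLp p n : Lp ℂ p (haarAddCircle : Measure UnitAddCircle)) = fourierLp p (-n) := by
  refine Lp.ext ?_
  filter_upwards [ae_star (fourierLp (T := 1) p n), coeFn_fourierLp (T := 1) p n,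
    coeFn_fourierLp (T := 1) p (-n)] with t h_star h_pos h_neg
  rw [h_star, h_pos, h_neg, fourier_neg]

lemma norm_zPow (n : ℤ) : ∀ᵐ t ∂(haarAddCircle : Measure UnitAddCircle), ‖zPow n t‖ = 1 := by
  filter_upwards [coeFn_fourierLp (T := 1) ⊤ n] with t ht
  rw [ht, fourier_apply, Circle.norm_coe]

lemma M_zPow_e (m n : ℤ) : M (zPow m) (e n) = e (m + n) := by
  refine Lp.ext ?_
  filter_upwards [ae_M (zPow m) (e n), coeFn_fourierLp (T := 1) ⊤ m,
    coeFn_fourierLp (T := 1) 2 n, coeFn_fourierLp (T := 1) 2 (m + n)] with t h_M hm hn h_add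
  rw [h_M, hm, hn, h_add, fourier_add]

lemma M_zPow_zero (x : L2) : M (zPow 0) x = x := by
  refine Lp.ext ?_
  filter_upwards [ae_M (zPow 0) x, coeFn_fourierLp (T := 1) ⊤ 0] with t h_M h_zero
  rw [h_M, h_zero, fourier_zero, one_mul]

lemma M_zPow_add (m n : ℤ) (x : L2) : M (zPow (m + n)) x = M (zPow m) (M (zPow n) x) := by
  refine Lp.ext ?_
  filter_upwards [ae_M (zPow (m + n)) x, ae_M (zPow m) (M (zPow n) x), ae_M (zPow n) x,
    coeFn_fourierLp (T := 1) ⊤ m, coeFn_fourierLp (T := 1) ⊤ n,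
    coeFn_fourierLp (T := 1) ⊤ (m + n)] with t h_M h_Mm h_Mn hm hn h_add
  rw [h_M, h_Mm, h_Mn, hm, hn, h_add, fourier_add, mul_assoc]

lemma star_z : star z = zPow (-1) := star_fourierLp ⊤ 1

lemma norm_z : ∀ᵐ t ∂(haarAddCircle : Measure UnitAddCircle), ‖z t‖ = 1 := norm_zPow 1

lemma norm_star_z : ∀ᵐ t ∂(haarAddCircle : Measure UnitAddCircle), ‖(star z : Linf) t‖ = 1 :=
  star_z ▸ norm_zPow (-1)

lemma const_eq_smul_e (c : ℂ) : Lp.const 2 haarAddCircle c = c • e 0 := by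
  refine Lp.ext ?_
  filter_upwards [Lp.coeFn_const (p := 2) (μ := (haarAddCircle : Measure UnitAddCircle)) c,
    Lp.coeFn_smul c (e 0), coeFn_fourierLp (T := 1) 2 0] with t h_const h_smul h_zero
  rw [h_const, h_smul, Pi.smul_apply, h_zero, fourier_zero, Function.const_apply, smul_eq_mul,
    mul_one]

lemma M_e_zero_ae_eq (a : Linf) :
    (M a (e 0) : UnitAddCircle → ℂ) =ᵐ[haarAddCircle] (a : UnitAddCircle → ℂ) := by
  filter_upwards [ae_M a (e 0), coeFn_fourierLp (T := 1) 2 0] with t h_M h_zero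
  rw [h_M, h_zero, fourier_zero, mul_one]

lemma ae_eq_iff_M_e_zero_eq {a : Linf} {f : L2} :
    ((a : UnitAddCircle → ℂ) =ᵐ[haarAddCircle] (f : UnitAddCircle → ℂ)) ↔ M a (e 0) = f :=
  ⟨fun h => Lp.ext ((M_e_zero_ae_eq a).trans h), fun h => h ▸ (M_e_zero_ae_eq a).symm⟩

lemma fourierCoeff_Linf (a : Linf) (n : ℤ) :
    fourierCoeff (a : UnitAddCircle → ℂ) n = ⟪e n, M a (e 0)⟫_ℂ := by
  rw [← coeff_eq_inner, fourierCoeff_congr_ae (M_e_zero_ae_eq a)]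

lemma inner_M_star (a b : Linf) (y : L2) :
    ⟪M b (e 0), M a (star y)⟫_ℂ = ⟪M b y, M a (e 0)⟫_ℂ := by
  refine inner_congr_ae ?_
  filter_upwards [M_e_zero_ae_eq a, M_e_zero_ae_eq b, ae_M a (star y), ae_M b y, ae_star y]
    with t ha hb h_star h_M hy
  rw [ha, hb, h_star, h_M, hy, map_mul]
  ring

lemma inner_e_M_zPow (m n : ℤ) (x : L2) : ⟪e n, M (zPow m) x⟫_ℂ = ⟪e (n - m), x⟫_ℂ := by
  rw [← star_star (zPow m), ← inner_M_left, star_fourierLp, M_zPow_e, neg_add_eq_sub]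

lemma inner_e_star (n : ℤ) (x : L2) : ⟪e n, star x⟫_ℂ = conj ⟪e (-n), x⟫_ℂ := by
  rw [inner_conj_symm, ← inner_star_star, star_star, star_fourierLp]

lemma inner_e_e (m n : ℤ) : ⟪e m, e n⟫_ℂ = if m = n then 1 else 0 :=
  orthonormal_iff_ite.mp orthonormal_fourier m n

lemma hasSum_inner_e (x y : L2) : HasSum (fun n : ℤ => ⟪x, e n⟫_ℂ * ⟪e n, y⟫_ℂ) ⟪x, y⟫_ℂ := by
  simpa only [coe_fourierBasis] using (fourierBasis (T := 1)).hasSum_inner_mul_inner x y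

end Fourier

section Hardy

lemma mem_H2_iff {x : L2} : x ∈ H2 ↔ ∀ n : ℤ, n < 0 → ⟪e n, x⟫_ℂ = 0 := by
  simp only [← coeff_eq_inner]
  exact Iff.rfl

lemma e_mem_H2 (n : ℕ) : e n ∈ H2 :=
  mem_H2_iff.mpr fun m hm => by rw [inner_e_e, if_neg (by omega)]

lemma hasSum_inner_e_of_mem_H2 (x : L2) {y : L2} (hy : y ∈ H2) :
    HasSum (fun n : ℕ => ⟪x, e n⟫_ℂ * ⟪e n, y⟫_ℂ) ⟪x, y⟫_ℂ := by
  refine ((Nat.cast_injective (R := ℤ)).hasSum_iff fun n hn => ?_).mpr (hasSum_inner_e x y)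
  have n_neg : n < 0 := by
    by_contra! n_nonneg
    exact hn ⟨n.toNat, Int.toNat_of_nonneg n_nonneg⟩
  rw [mem_H2_iff.mp hy n n_neg, mul_zero]

lemma hasSum_norm_sq_inner_e {x : L2} (hx : x ∈ H2) :
    HasSum (fun n : ℕ => ‖⟪e n, x⟫_ℂ‖ ^ 2) (‖x‖ ^ 2) := by
  rw [← Complex.hasSum_ofReal]
  convert hasSum_inner_e_of_mem_H2 x hx with n
  · rw [← inner_conj_symm x, Complex.conj_mul', Complex.ofReal_pow]
  · rw [inner_self_eq_norm_sq_to_K, Complex.ofReal_pow]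
    rfl

lemma mem_H2_orthogonal_iff {x : L2} : x ∈ H2ᗮ ↔ ∀ n : ℕ, ⟪e n, x⟫_ℂ = 0 := by
  refine ⟨fun h n => h (e n) (e_mem_H2 n), fun h y hy => inner_eq_zero_symm.mp ?_⟩
  refine (hasSum_inner_e_of_mem_H2 x hy).unique ?_
  convert hasSum_zero with n
  rw [← inner_conj_symm, h, map_zero, zero_mul]

lemma M_zPow_mem_H2 (n : ℕ) {x : L2} (hx : x ∈ H2) : M (zPow n) x ∈ H2 :=
  mem_H2_iff.mpr fun m hm => by rw [inner_e_M_zPow, mem_H2_iff.mp hx _ (by omega)]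

instance : CompleteSpace H2 := isClosed_H2.completeSpace_coe

lemma star_mem_H2_of_mem_orthogonal {x : L2} (hx : x ∈ H2ᗮ) : star x ∈ H2 := by
  refine mem_H2_iff.mpr fun n hn => ?_
  lift -n to ℕ using by omega with m hm
  rw [inner_e_star, ← hm, mem_H2_orthogonal_iff.mp hx, map_zero]

lemma exists_analytic_add_antianalytic (Φ : L2) : ∃ φ ∈ H2, ∃ ψ ∈ H2, Φ = φ + star ψ := by
  obtain ⟨φ, hφ, y, hy, h⟩ := Submodule.exists_add_mem_mem_orthogonal (K := H2) Φ
  exact ⟨φ, hφ, star y, star_mem_H2_of_mem_orthogonal hy, by rw [star_star, h]⟩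

end Hardy

/-- The operator-theoretic data of a model space: the compressed shift `S`, the conjugation `C`, the
reproducing kernel `k` at `0` and the number `w = u(0)`, with the identities that relate them. All
of the algebra of truncated Toeplitz operators is derived from these identities. -/
structure CompressedShift (K : Type*) [NormedAddCommGroup K] [InnerProductSpace ℂ K]
    [CompleteSpace K] where
  S : K →L[ℂ] K
  C : K →ₗ⋆[ℂ] K
  k : K
  w : ℂ
  C_C (f : K) : C (C f) = f
  inner_C_C (f g : K) : ⟪C f, C g⟫_ℂ = ⟪g, f⟫_ℂ
  C_S (f : K) : C (S f) = S.adjoint (C f)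
  S_adjoint (f : K) : S (S.adjoint f) = f - ⟪k, f⟫_ℂ • k
  adjoint_k : S.adjoint k = -(conj w • C k)
  hasSum_norm_sq (f : K) : HasSum (fun n : ℕ => ‖⟪k, (S.adjoint ^ n) f⟫_ℂ‖ ^ 2) (‖f‖ ^ 2)

namespace CompressedShift

variable {K : Type*} [NormedAddCommGroup K] [InnerProductSpace ℂ K] [CompleteSpace K]
  (X : CompressedShift K)

/-- The backward shift, the adjoint of `S`. -/
def R : K →L[ℂ] K := X.S.adjoint

/-- The conjugate-linear map `f ↦ S C f`, an involution up to multiples of `k`. -/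
def J : K →ₗ⋆[ℂ] K := X.S.toLinearMap.comp X.C

/-- The line spanned by `k`. -/
abbrev line : Submodule ℂ K := Submodule.span ℂ {X.k}

lemma C_R (f : K) : X.C (X.R f) = X.J f := by
  have h := X.C_S (X.C f)
  rw [X.C_C] at h
  rw [R, ← h, X.C_C, J, LinearMap.comp_apply]
  rfl

lemma C_J (f : K) : X.C (X.J f) = X.R f := by rw [← C_R, X.C_C]

lemma S_C (f : K) : X.S (X.C f) = X.J f := rfl

lemma J_C (f : K) : X.J (X.C f) = X.S f := congrArg X.S (X.C_C f)

lemma S_R (f : K) : X.S (X.R f) = f - ⟪X.k, f⟫_ℂ • X.k := X.S_adjoint f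

lemma inner_C_left (f g : K) : ⟪X.C f, g⟫_ℂ = ⟪X.C g, f⟫_ℂ := by
  conv_lhs => rw [← X.C_C g, X.inner_C_C]

lemma inner_R_left (f g : K) : ⟪X.R f, g⟫_ℂ = ⟪f, X.S g⟫_ℂ := X.S.adjoint_inner_left g f

lemma inner_R_right (f g : K) : ⟪f, X.R g⟫_ℂ = ⟪X.S f, g⟫_ℂ := X.S.adjoint_inner_right f g

lemma R_k : X.R X.k = -(conj X.w • X.C X.k) := X.adjoint_k

lemma J_k : X.J X.k = -(X.w • X.k) := by
  rw [← C_R, R_k, map_neg, map_smulₛₗ, Complex.conj_conj, X.C_C]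

lemma J_J (f : K) : X.J (X.J f) = f - ⟪X.k, f⟫_ℂ • X.k := by
  rw [← S_R, ← C_J]
  rfl

lemma R_S (f : K) : X.R (X.S f) = f - ⟪X.C X.k, f⟫_ℂ • X.C X.k := by
  rw [← J_C, ← C_J, J_J, map_sub, map_smulₛₗ, X.C_C, inner_conj_symm, inner_C_left]

lemma k_mem_line : X.k ∈ X.line := Submodule.mem_span_singleton_self _

lemma J_mem_line_iff {f : K} : X.J f ∈ X.line ↔ f ∈ X.line := by
  have J_mem {f : K} (hf : f ∈ X.line) : X.J f ∈ X.line := by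
    obtain ⟨c, rfl⟩ := Submodule.mem_span_singleton.mp hf
    rw [map_smulₛₗ, J_k]
    exact X.line.smul_mem _ (X.line.neg_mem (X.line.smul_mem _ X.k_mem_line))
  refine ⟨fun hf => ?_, J_mem⟩
  have hJJ := J_mem hf
  rwa [J_J, X.line.sub_mem_iff_left (X.line.smul_mem _ X.k_mem_line)] at hJJ

lemma mem_line_iff {x : K} : x ∈ X.line ↔ ∀ f, ⟪X.k, f⟫_ℂ = 0 → ⟪x, f⟫_ℂ = 0 := by
  rw [line, ← Submodule.orthogonal_orthogonal (Submodule.span ℂ {X.k}), Submodule.mem_orthogonal']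
  simp only [Submodule.mem_orthogonal_singleton_iff_inner_right]

lemma inner_R_pow_left (n : ℕ) (f g : K) : ⟪(X.R ^ n) f, g⟫_ℂ = ⟪f, (X.S ^ n) g⟫_ℂ := by
  rw [R, ← ContinuousLinearMap.star_eq_adjoint, ← star_pow, ContinuousLinearMap.star_eq_adjoint,
    ContinuousLinearMap.adjoint_inner_left]

lemma inner_R_pow_right (n : ℕ) (f g : K) : ⟪f, (X.R ^ n) g⟫_ℂ = ⟪(X.S ^ n) f, g⟫_ℂ := by
  rw [← inner_conj_symm, inner_R_pow_left, inner_conj_symm]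

lemma R_pow_C (n : ℕ) (f : K) : (X.R ^ n) (X.C f) = X.C ((X.S ^ n) f) := by
  induction n generalizing f with
  | zero => rfl
  | succ n ih => exact (congrArg (X.R ^ n) (X.C_S f).symm).trans (ih (X.S f))

lemma eq_of_inner_S_pow_k {f g : K} (h : ∀ n : ℕ, ⟪f, (X.S ^ n) X.k⟫_ℂ = ⟪g, (X.S ^ n) X.k⟫_ℂ) :
    f = g := by
  rw [← sub_eq_zero, ← norm_eq_zero, ← sq_eq_zero_iff]
  refine (X.hasSum_norm_sq (f - g)).unique ?_
  convert hasSum_zero with n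
  change ‖⟪X.k, (X.R ^ n) (f - g)⟫_ℂ‖ ^ 2 = 0
  rw [inner_R_pow_right, inner_sub_right, ← inner_conj_symm, h, inner_conj_symm, sub_self,
    norm_zero, zero_pow two_ne_zero]

lemma tendsto_R_pow (f : K) : Tendsto (fun n : ℕ => (X.R ^ n) f) atTop (𝓝 0) := by
  rw [tendsto_zero_iff_norm_tendsto_zero]
  have tail (n : ℕ) : ∑' j, ‖⟪X.k, (X.R ^ (j + n)) f⟫_ℂ‖ ^ 2 = ‖(X.R ^ n) f‖ ^ 2 := by
    rw [← (X.hasSum_norm_sq ((X.R ^ n) f)).tsum_eq]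
    simp only [pow_add, mul_apply_eq_comp]
    rfl
  have tail_tendsto := tendsto_sum_nat_add fun j : ℕ => ‖⟪X.k, (X.R ^ j) f⟫_ℂ‖ ^ 2
  simpa only [tail, Function.comp_def, Real.sqrt_sq (norm_nonneg _), Real.sqrt_zero] using
    (Real.continuous_sqrt.tendsto 0).comp tail_tendsto

lemma k_ne_zero [Nontrivial K] : X.k ≠ 0 := by
  intro hk
  obtain ⟨f, hf⟩ := exists_ne (0 : K)
  exact hf (X.eq_of_inner_S_pow_k fun n => by
    rw [hk, map_zero, inner_zero_right, inner_zero_right])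

lemma inner_C_k_C_k_ne_zero [Nontrivial K] : ⟪X.C X.k, X.C X.k⟫_ℂ ≠ 0 := by
  rw [X.inner_C_C]
  exact inner_self_ne_zero.mpr X.k_ne_zero

lemma inner_k_k [Nontrivial K] : ⟪X.k, X.k⟫_ℂ = 1 - X.w * conj X.w := by
  have hSR : (X.w * conj X.w) • X.k = (1 - ⟪X.k, X.k⟫_ℂ) • X.k := by
    rw [sub_smul, one_smul, ← S_R, R_k, map_neg, map_smul, S_C, J_k, smul_neg, neg_neg, smul_smul,
      mul_comm]
  rw [smul_left_injective ℂ X.k_ne_zero hSR, sub_sub_cancel]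

/-- `T - S T R` is the operator `a ⊗ k + k ⊗ a'` of rank at most two. -/
def HasDefect (T : K →L[ℂ] K) (a a' : K) : Prop :=
  ∀ f, T f - X.S (T (X.R f)) = ⟪X.k, f⟫_ℂ • a + ⟪a', f⟫_ℂ • X.k

variable {X} {A B T : K →L[ℂ] K} {a a' b b' : K}

lemma hasDefect_one : X.HasDefect 1 X.k 0 := fun f => by
  rw [one_apply_eq_self, one_apply_eq_self, S_R, inner_zero_left, zero_smul,
    add_zero, sub_sub_cancel]

lemma HasDefect.tendsto_sum (h : X.HasDefect T a a') (f g : K) :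
    Tendsto (fun n => ∑ j ∈ Finset.range n, (⟪X.k, (X.R ^ j) f⟫_ℂ * ⟪(X.R ^ j) g, a⟫_ℂ +
      ⟪a', (X.R ^ j) f⟫_ℂ * ⟪(X.R ^ j) g, X.k⟫_ℂ)) atTop (𝓝 ⟪g, T f⟫_ℂ) := by
  have difference (j : ℕ) : ⟪X.k, (X.R ^ j) f⟫_ℂ * ⟪(X.R ^ j) g, a⟫_ℂ +
      ⟪a', (X.R ^ j) f⟫_ℂ * ⟪(X.R ^ j) g, X.k⟫_ℂ =
      ⟪(X.R ^ j) g, T ((X.R ^ j) f)⟫_ℂ - ⟪(X.R ^ (j + 1)) g, T ((X.R ^ (j + 1)) f)⟫_ℂ := by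
    rw [pow_succ', mul_apply_eq_comp, mul_apply_eq_comp, inner_R_left, ← inner_sub_right, h,
      inner_add_right, inner_smul_right, inner_smul_right]
  simp only [difference, Finset.sum_range_sub']
  have remainder : Tendsto (fun n => ⟪(X.R ^ n) g, T ((X.R ^ n) f)⟫_ℂ) atTop (𝓝 ⟪0, T 0⟫_ℂ) :=
    (X.tendsto_R_pow g).inner ((T.continuous.tendsto 0).comp (X.tendsto_R_pow f))
  rw [inner_zero_left] at remainder
  simpa only [sub_zero, pow_zero, one_apply_eq_self] using remainder.const_sub ⟪g, T f⟫_ℂ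

lemma hasDefect_of_hasSum {D : Set K} (hD : Dense D) (hR : ∀ f ∈ D, X.R f ∈ D)
    (h : ∀ f ∈ D, ∀ g ∈ D, HasSum (fun j : ℕ => ⟪X.k, (X.R ^ j) f⟫_ℂ * ⟪(X.R ^ j) g, a⟫_ℂ +
      ⟪a', (X.R ^ j) f⟫_ℂ * ⟪(X.R ^ j) g, X.k⟫_ℂ) ⟪g, T f⟫_ℂ) : X.HasDefect T a a' := by
  refine congrFun (Continuous.ext_on hD (by fun_prop) (by fun_prop) fun f hf => ?_)
  refine hD.eq_of_inner_right ℂ fun g hg => ?_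
  have tail := (hasSum_nat_add_iff' 1).mpr (h f hf g hg)
  simp only [pow_succ, mul_apply_eq_comp] at tail
  have first_term := (h (X.R f) (hR f hf) (X.R g) (hR g hg)).unique tail
  rw [Finset.sum_range_one, pow_zero, one_apply_eq_self, one_apply_eq_self, inner_R_left,
    eq_sub_iff_add_eq'] at first_term
  rw [inner_sub_right, ← first_term, add_sub_cancel_right, inner_add_right, inner_smul_right,
    inner_smul_right]

variable (X) in
lemma tendsto_sum_inner (f g : K) :
    Tendsto (fun n => ∑ j ∈ Finset.range n, ⟪X.k, (X.R ^ j) f⟫_ℂ * ⟪(X.R ^ j) g, X.k⟫_ℂ) atTop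
      (𝓝 ⟪g, f⟫_ℂ) := by
  simpa using X.hasDefect_one.tendsto_sum f g

-- Paired with `C (S ^ m k)`, both sides are limits of the same telescoping sums.
lemma HasDefect.S_apply_C_k (h : X.HasDefect T a a') :
    X.S (T (X.C X.k)) = X.J a' - X.w • a := by
  rw [← X.C_C (X.S _), ← X.C_C (_ - _)]
  refine congrArg X.C (X.eq_of_inner_S_pow_k fun m => ?_)
  rw [inner_C_left _ (X.S _), inner_C_left _ (_ - _)]
  set g := X.C ((X.S ^ m) X.k) with hg
  have inner_R_pow_a (j : ℕ) :
      ⟪(X.R ^ j) (X.R g), a⟫_ℂ = ⟪(X.R ^ j) ((X.R ^ (m + 1)) (X.C a)), X.k⟫_ℂ := by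
    simp only [hg, ← R_pow_C, ← mul_apply_eq_comp, ← pow_succ', ← pow_add]
    rw [R_pow_C, inner_C_left, inner_R_pow_left]
  have inner_a'_R_pow (j : ℕ) : ⟪a', (X.R ^ j) (X.C X.k)⟫_ℂ = ⟪X.k, (X.R ^ j) (X.C a')⟫_ℂ := by
    rw [R_pow_C, inner_R_pow_right, ← X.inner_C_C, X.C_C]
  have h_sum := h.tendsto_sum (X.C X.k) (X.R g)
  simp only [inner_R_pow_a, inner_a'_R_pow, Finset.sum_add_distrib] at h_sum
  have h_lim := tendsto_nhds_unique h_sum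
    ((X.tendsto_sum_inner _ _).add (X.tendsto_sum_inner _ _))
  have inner_C_a : ⟪(X.R ^ (m + 1)) (X.C a), X.C X.k⟫_ℂ = -(X.w * ⟪g, a⟫_ℂ) := by
    rw [pow_succ', mul_apply_eq_comp, inner_R_left, S_C, J_k, inner_neg_right, inner_smul_right,
      inner_R_pow_left, hg, inner_C_left]
  rw [← inner_R_left, h_lim, inner_C_a, inner_R_left, S_C, inner_sub_right, inner_smul_right]
  ring

lemma HasDefect.commutator_S (h : X.HasDefect T a a') (f : K) :
    T (X.S f) - X.S (T f) = ⟪X.C (X.J a'), f⟫_ℂ • X.k - ⟪X.C X.k, f⟫_ℂ • X.J a' := by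
  have hf := h (X.S f)
  simp only [R_S, map_sub, map_smul, h.S_apply_C_k, ← inner_R_left, R_k, inner_neg_left,
    inner_smul_left, Complex.conj_conj] at hf
  rw [C_J, eq_sub_of_add_eq' hf.symm]
  module

-- The form `G` of the proof is alternating and `S` is symmetric for it, so that `G` vanishes at all
-- pairs of the vectors `S ^ n k`, which span a dense subspace.
lemma HasDefect.inner_C_comm (h : X.HasDefect T a a') (f g : K) :
    ⟪X.C f, T g⟫_ℂ = ⟪X.C g, T f⟫_ℂ := by
  set G : K → K → ℂ := fun f g => ⟪X.C g, T f⟫_ℂ - ⟪X.C f, T g⟫_ℂ with hG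
  have G_apply_C (f : K) : ∃ x, ∀ g, G f g = ⟪x, g⟫_ℂ := by
    refine ⟨X.C (T f) - T.adjoint (X.C f), fun g => ?_⟩
    rw [inner_sub_left, ContinuousLinearMap.adjoint_inner_left, inner_C_left]
  have G_swap (f g : K) : G g f = -G f g := (neg_sub _ _).symm
  have G_S (f g : K) : G (X.S f) g = G f (X.S g) := by
    have hf := congrArg (fun x => ⟪X.C g, x⟫_ℂ) (h.commutator_S f)
    have hg := congrArg (fun x => ⟪X.C f, x⟫_ℂ) (h.commutator_S g)
    simp only [inner_sub_right, inner_smul_right, X.inner_C_left f X.k, X.inner_C_left g X.k,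
      X.inner_C_left f (X.J a'), X.inner_C_left g (X.J a')] at hf hg
    simp only [hG, C_S, ContinuousLinearMap.adjoint_inner_left]
    linear_combination hf + hg
  have G_S_pow (m : ℕ) (f g : K) : G ((X.S ^ m) f) g = G f ((X.S ^ m) g) := by
    induction m generalizing f with
    | zero => rfl
    | succ m ih => exact (ih (X.S f)).trans (by rw [G_S, pow_succ', mul_apply_eq_comp])
  have G_S_pow_k (m n : ℕ) : G ((X.S ^ m) X.k) ((X.S ^ n) X.k) = 0 := by
    rw [G_S_pow, ← mul_apply_eq_comp, ← pow_add]
    exact self_eq_neg.mp ((G_S_pow _ _ _).symm.trans (G_swap _ _))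
  have eq_zero {f : K} (hf : ∀ n : ℕ, G f ((X.S ^ n) X.k) = 0) (g : K) : G f g = 0 := by
    obtain ⟨x, hx⟩ := G_apply_C f
    rw [hx, X.eq_of_inner_S_pow_k (f := x) (g := 0) fun n => by rw [← hx, hf, inner_zero_left],
      inner_zero_left]
  refine sub_eq_zero.mp (eq_zero (fun n => ?_) f)
  rw [G_swap, eq_zero fun m => G_S_pow_k n m, neg_zero]

lemma HasDefect.inner_C_apply_left (h : X.HasDefect T a a') (f g : K) :
    ⟪X.C (T f), g⟫_ℂ = ⟪X.C f, T g⟫_ℂ :=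
  (X.inner_C_left _ _).trans (h.inner_C_comm g f)

lemma HasDefect.mul_comm (hA : X.HasDefect A a a') (hB : X.HasDefect B b b') {c c' : K}
    (hAB : X.HasDefect (A * B) c c') : A * B = B * A := by
  ext f
  refine ext_inner_left ℂ fun g => ?_
  rw [← X.C_C g, hAB.inner_C_comm, mul_apply_eq_comp, mul_apply_eq_comp, ← hA.inner_C_apply_left,
    hB.inner_C_comm]

lemma HasDefect.apply_k [Nontrivial K] (h : X.HasDefect T a a') :
    T X.k = a - conj X.w • X.J a' + ⟪a', X.k⟫_ℂ • X.k := by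
  have hk := h X.k
  rw [R_k, map_neg, map_neg, map_smul, map_smul, h.S_apply_C_k, inner_k_k] at hk
  rw [eq_add_of_sub_eq hk]
  module

lemma exists_hasDefect_iff :
    (∃ a a', X.HasDefect T a a') ↔ ∀ f, ⟪X.k, f⟫_ℂ = 0 → T f - X.S (T (X.R f)) ∈ X.line := by
  constructor
  · rintro ⟨a, a', h⟩ f hf
    rw [h, hf, zero_smul, zero_add]
    exact X.line.smul_mem _ X.k_mem_line
  intro h
  set D : K →L[ℂ] K := T - X.S ∘L T ∘L X.R
  set r : ℂ := ((‖X.k‖ ^ 2 : ℝ) : ℂ)⁻¹ with hr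
  have proj (f : K) : X.line.starProjection f = (r * ⟪X.k, f⟫_ℂ) • X.k := by
    rw [Submodule.starProjection_singleton, div_eq_inv_mul, hr]
    rfl
  refine ⟨r • (D X.k - X.line.starProjection (D X.k)), r • D.adjoint X.k, fun f => ?_⟩
  have D_sub_proj : D (f - X.line.starProjection f) ∈ X.line := by
    refine h _ ?_
    have := Submodule.sub_starProjection_mem_orthogonal (K := X.line) f
    exact (Submodule.mem_orthogonal_singleton_iff_inner_right).mp this
  have hf := Submodule.starProjection_eq_self_iff.mpr D_sub_proj
  change D f = _
  rw [proj, map_sub, proj f, map_smul, inner_sub_right, inner_smul_right] at hf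
  rw [proj (D X.k), eq_add_of_sub_eq hf.symm, inner_smul_left,
    ContinuousLinearMap.adjoint_inner_left, map_inv₀, Complex.conj_ofReal, ← hr]
  module

variable (X) in
/-- An operator with defect `a ⊗ k + k ⊗ a'` is of type `p`, a point of the projective line in
homogeneous coordinates, if `p.1 • a` and `p.2 • J a'` agree up to a multiple of `k`. -/
def IsType (p : ℂ × ℂ) (a a' : K) : Prop := p.1 • a - p.2 • X.J a' ∈ X.line

lemma isType_iff {p : ℂ × ℂ} : X.IsType p b b' ↔
    ∀ f, ⟪X.k, f⟫_ℂ = 0 → p.1 * ⟪X.J b, f⟫_ℂ = p.2 * ⟪b', f⟫_ℂ := by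
  rw [IsType, ← J_mem_line_iff, mem_line_iff]
  refine forall₂_congr fun f hf => ?_
  rw [map_sub, map_smulₛₗ, map_smulₛₗ, J_J, inner_sub_left, inner_smul_left, inner_smul_left,
    inner_sub_left, inner_smul_left, hf, Complex.conj_conj, Complex.conj_conj, mul_zero, sub_zero,
    sub_eq_zero]

lemma HasDefect.mul_sub_mem_line [Nontrivial K] (hA : X.HasDefect A a a')
    (hB : X.HasDefect B b b') {f : K} (hf : ⟪X.k, f⟫_ℂ = 0) :
    A (B f) - X.S (A (B (X.R f))) - (⟪b', f⟫_ℂ • a - ⟪X.J b, f⟫_ℂ • X.J a') ∈ X.line := by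
  have defect_eq : A (B f) - X.S (A (B (X.R f))) =
      A (B f - X.S (B (X.R f))) + (A (X.S (B (X.R f))) - X.S (A (B (X.R f)))) := by
    rw [map_sub, sub_add_sub_cancel]
  have inner_B : ⟪X.C X.k, B (X.R f)⟫_ℂ = ⟪X.J b, f⟫_ℂ - conj X.w * ⟪b', f⟫_ℂ := by
    rw [← hB.inner_C_apply_left, inner_R_right, S_C, hB.apply_k]
    simp only [map_add, map_sub, map_smulₛₗ, J_J, J_k, inner_add_left, inner_sub_left,
      inner_smul_left, inner_neg_left, hf, Complex.conj_conj]
    ring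
  rw [defect_eq, hB, hf, zero_smul, zero_add, map_smul, hA.apply_k, hA.commutator_S, inner_B]
  refine Submodule.mem_span_singleton.mpr
    ⟨⟪b', f⟫_ℂ * ⟪a', X.k⟫_ℂ + ⟪X.C (X.J a'), B (X.R f)⟫_ℂ, ?_⟩
  module

lemma exists_hasDefect_mul_iff [Nontrivial K] (hA : X.HasDefect A a a')
    (hB : X.HasDefect B b b') :
    (∃ c c', X.HasDefect (A * B) c c') ↔
      ∀ f, ⟪X.k, f⟫_ℂ = 0 → ⟪b', f⟫_ℂ • a - ⟪X.J b, f⟫_ℂ • X.J a' ∈ X.line := by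
  rw [exists_hasDefect_iff]
  refine forall₂_congr fun f hf => ?_
  have hmem := hA.mul_sub_mem_line hB hf
  exact ⟨fun h => (X.line.sub_mem_iff_right h).mp hmem,
    fun h => (X.line.sub_mem_iff_left h).mp hmem⟩

lemma exists_hasDefect_mul_of_isType [Nontrivial K] (hA : X.HasDefect A a a')
    (hB : X.HasDefect B b b') {p : ℂ × ℂ} (hp : p ≠ 0)
    (tA : X.IsType p a a') (tB : X.IsType p b b') : ∃ c c', X.HasDefect (A * B) c c' := by
  refine (exists_hasDefect_mul_iff hA hB).mpr fun f hf => ?_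
  have hBf := isType_iff.mp tB f hf
  have fst_smul : p.1 • (⟪b', f⟫_ℂ • a - ⟪X.J b, f⟫_ℂ • X.J a') =
      ⟪b', f⟫_ℂ • (p.1 • a - p.2 • X.J a') := by
    rw [smul_sub, smul_smul, smul_smul, hBf]
    module
  have snd_smul : p.2 • (⟪b', f⟫_ℂ • a - ⟪X.J b, f⟫_ℂ • X.J a') =
      ⟪X.J b, f⟫_ℂ • (p.1 • a - p.2 • X.J a') := by
    rw [smul_sub, smul_smul, ← hBf]
    module
  obtain hp1 | hp2 : p.1 ≠ 0 ∨ p.2 ≠ 0 := by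
    by_contra! h
    exact hp (Prod.ext h.1 h.2)
  · exact (X.line.smul_mem_iff hp1).mp (fst_smul ▸ X.line.smul_mem _ tA)
  · exact (X.line.smul_mem_iff hp2).mp (snd_smul ▸ X.line.smul_mem _ tA)

/-- A point of the Riemann sphere in homogeneous coordinates: `∞ = (1 : 0)` and `α = (α : 1)`. -/
def homogeneousCoord : OnePoint ℂ → ℂ × ℂ
  | OnePoint.infty => (1, 0)
  | OnePoint.some α => (α, 1)

lemma exists_isType_of_sq [Nontrivial K] (hA : X.HasDefect A a a')
    (hAA : ∃ c c', X.HasDefect (A * A) c c') : ∃ α, X.IsType (homogeneousCoord α) a a' := by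
  by_cases ha : a ∈ X.line
  · exact ⟨OnePoint.infty, by simpa [IsType, homogeneousCoord] using ha⟩
  obtain ⟨f, hf, hJf⟩ : ∃ f, ⟪X.k, f⟫_ℂ = 0 ∧ ⟪X.J a, f⟫_ℂ ≠ 0 := by
    simpa [mem_line_iff] using X.J_mem_line_iff.not.mpr ha
  have hmem := (exists_hasDefect_mul_iff hA hA).mp hAA f hf
  refine ⟨OnePoint.some (⟪a', f⟫_ℂ / ⟪X.J a, f⟫_ℂ), (X.line.smul_mem_iff hJf).mp ?_⟩
  simpa [homogeneousCoord, smul_sub, smul_smul, mul_div_cancel₀ _ hJf] using hmem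

lemma IsType.of_mul [Nontrivial K] (hA : X.HasDefect A a a')
    (hB : X.HasDefect B b b') (hAB : ∃ c c', X.HasDefect (A * B) c c')
    {p : ℂ × ℂ} (tA : X.IsType p a a') (hne : ¬ (a ∈ X.line ∧ X.J a' ∈ X.line)) :
    X.IsType p b b' := by
  refine isType_iff.mpr fun f hf => ?_
  have hmem := (exists_hasDefect_mul_iff hA hB).mp hAB f hf
  set q := p.1 * ⟪X.J b, f⟫_ℂ - p.2 * ⟪b', f⟫_ℂ with hq
  have smul_a : q • a = ⟪X.J b, f⟫_ℂ • (p.1 • a - p.2 • X.J a') -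
      p.2 • (⟪b', f⟫_ℂ • a - ⟪X.J b, f⟫_ℂ • X.J a') := by
    rw [hq]; module
  have smul_J : q • X.J a' = ⟪b', f⟫_ℂ • (p.1 • a - p.2 • X.J a') -
      p.1 • (⟪b', f⟫_ℂ • a - ⟪X.J b, f⟫_ℂ • X.J a') := by
    rw [hq]; module
  have mem_line (c d : ℂ) := X.line.sub_mem (X.line.smul_mem c tA) (X.line.smul_mem d hmem)
  by_contra hq_ne
  rw [← sub_eq_zero, ← hq] at hq_ne
  exact hne ⟨(X.line.smul_mem_iff hq_ne).mp (smul_a ▸ mem_line _ _),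
    (X.line.smul_mem_iff hq_ne).mp (smul_J ▸ mem_line _ _)⟩

variable (X) in
/-- The generalized Clark perturbation `S + α / (1 - α * conj w) • (k ⊗ C k)`, `α = p.1 / p.2`, of
the shift, with denominators cleared so that it makes sense for `α = ∞` and `α = 1 / conj w`. -/
def pencil (p : ℂ × ℂ) : K →L[ℂ] K :=
  (p.2 - p.1 * conj X.w) • X.S + p.1 • InnerProductSpace.rankOne ℂ X.k (X.C X.k)

lemma pencil_apply (p : ℂ × ℂ) (f : K) :
    X.pencil p f = (p.2 - p.1 * conj X.w) • X.S f + p.1 • ⟪X.C X.k, f⟫_ℂ • X.k := rfl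

lemma hasDefect_pencil (p : ℂ × ℂ) :
    X.HasDefect (X.pencil p) (p.2 • X.S X.k) (conj p.1 • X.C X.k) := fun f => by
  have inner_C_k_R : ⟪X.C X.k, X.R f⟫_ℂ = -(conj X.w * ⟪X.k, f⟫_ℂ) := by
    rw [inner_R_right, S_C, J_k, inner_neg_left, inner_smul_left]
  simp only [pencil_apply, S_R, map_add, map_sub, map_smul, inner_C_k_R, inner_smul_left,
    Complex.conj_conj]
  module

lemma isType_pencil (p : ℂ × ℂ) : X.IsType p (p.2 • X.S X.k) (conj p.1 • X.C X.k) := by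
  rw [IsType, map_smulₛₗ, Complex.conj_conj, J_C, smul_comm, sub_self]
  exact X.line.zero_mem

lemma HasDefect.commutator_pencil [Nontrivial K] (h : X.HasDefect T a a')
    (p : ℂ × ℂ) (f : K) : X.pencil p (T f) - T (X.pencil p f) =
      ⟪X.C (p.1 • a - p.2 • X.J a'), f⟫_ℂ • X.k - ⟪X.C X.k, f⟫_ℂ • (p.1 • a - p.2 • X.J a') := by
  have comm_S := h.commutator_S f
  rw [sub_eq_iff_eq_add] at comm_S
  simp only [pencil_apply, map_add, map_smul, comm_S, ← h.inner_C_apply_left, h.apply_k,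
    map_sub, map_smulₛₗ, inner_add_left, inner_sub_left, inner_smul_left, Complex.conj_conj]
  module

lemma mem_line_iff_forall_smul_eq [Nontrivial K] {v : K} :
    v ∈ X.line ↔ ∀ f, ⟪X.C v, f⟫_ℂ • X.k = ⟪X.C X.k, f⟫_ℂ • v := by
  constructor
  · intro hv f
    obtain ⟨c, rfl⟩ := Submodule.mem_span_singleton.mp hv
    rw [map_smulₛₗ, inner_smul_left, Complex.conj_conj, smul_smul, mul_comm]
  · intro h
    exact (X.line.smul_mem_iff X.inner_C_k_C_k_ne_zero).mp
      (h (X.C X.k) ▸ X.line.smul_mem _ X.k_mem_line)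

lemma HasDefect.commute_pencil_iff [Nontrivial K] (h : X.HasDefect T a a')
    (p : ℂ × ℂ) : X.pencil p * T = T * X.pencil p ↔ X.IsType p a a' := by
  rw [IsType, mem_line_iff_forall_smul_eq, ContinuousLinearMap.ext_iff]
  refine forall_congr' fun f => ?_
  rw [← sub_eq_zero, ← sub_eq_zero (b := _ • (_ - _)), ← h.commutator_pencil]
  rfl

lemma HasDefect.add (hA : X.HasDefect A a a') (hB : X.HasDefect B b b') :
    X.HasDefect (A + B) (a + b) (a' + b') := fun f => by
  rw [add_apply, add_apply, map_add, add_sub_add_comm, hA, hB, inner_add_left]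
  module

lemma HasDefect.smul (hA : X.HasDefect A a a') (c : ℂ) :
    X.HasDefect (c • A) (c • a) (conj c • a') := fun f => by
  rw [smul_apply, smul_apply, map_smul, ← smul_sub, hA,
    inner_smul_left, Complex.conj_conj]
  module

lemma hasDefect_add_smul_k_left {c : ℂ} :
    X.HasDefect T (a + c • X.k) a' ↔ X.HasDefect T a (a' + conj c • X.k) := by
  refine forall_congr' fun f => Eq.congr_right ?_
  rw [inner_add_left, inner_smul_left, Complex.conj_conj]
  module

variable (X) in
/-- The operators `T` for which `T - S T R` has the form `a ⊗ k + k ⊗ a'`; for a model space these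
are the bounded truncated Toeplitz operators. -/
def toeplitz : Submodule ℂ (K →L[ℂ] K) where
  carrier := {T | ∃ a a', X.HasDefect T a a'}
  add_mem' := fun ⟨_, _, hA⟩ ⟨_, _, hB⟩ => ⟨_, _, hA.add hB⟩
  zero_mem' := ⟨0, 0, fun f => by simp⟩
  smul_mem' := fun c _ ⟨_, _, hA⟩ => ⟨_, _, hA.smul c⟩

lemma mem_toeplitz_iff_inner : T ∈ X.toeplitz ↔
    ∀ f g, ⟪X.k, f⟫_ℂ = 0 → ⟪X.k, g⟫_ℂ = 0 → ⟪g, T f⟫_ℂ = ⟪X.R g, T (X.R f)⟫_ℂ := by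
  refine exists_hasDefect_iff.trans (forall_congr' fun f => ?_)
  simp only [mem_line_iff, ← imp_forall_iff]
  refine forall₃_congr fun _ g _ => ?_
  rw [inner_R_left, ← sub_eq_zero (a := ⟪g, _⟫_ℂ), ← inner_sub_right, inner_eq_zero_symm]

lemma homogeneousCoord_ne_zero (α : OnePoint ℂ) : homogeneousCoord α ≠ 0 := by
  cases α <;> simp [homogeneousCoord]

variable [Nontrivial K]

variable (X) in
/-- The elements of `X.toeplitz` of type `α`, described as those commuting with the pencil. -/
def typeAlgebra (α : OnePoint ℂ) : Subalgebra ℂ (K →L[ℂ] K) where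
  carrier := X.toeplitz ∩ Subalgebra.centralizer ℂ {X.pencil (homogeneousCoord α)}
  mul_mem' := by
    rintro A B ⟨⟨a, a', hA⟩, cA⟩ ⟨⟨b, b', hB⟩, cB⟩
    have tA := (hA.commute_pencil_iff _).mp (cA _ rfl)
    have tB := (hB.commute_pencil_iff _).mp (cB _ rfl)
    exact ⟨exists_hasDefect_mul_of_isType hA hB (homogeneousCoord_ne_zero α) tA tB, mul_mem cA cB⟩
  add_mem' hA hB := ⟨add_mem hA.1 hB.1, add_mem hA.2 hB.2⟩
  algebraMap_mem' c := by
    refine ⟨?_, Subalgebra.algebraMap_mem _ c⟩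
    rw [Algebra.algebraMap_eq_smul_one]
    exact X.toeplitz.smul_mem c ⟨_, _, hasDefect_one⟩

lemma typeAlgebra_subset (α : OnePoint ℂ) : (X.typeAlgebra α : Set (K →L[ℂ] K)) ⊆ X.toeplitz :=
  fun _ hT => hT.1

lemma mem_typeAlgebra_iff {α : OnePoint ℂ} : T ∈ X.typeAlgebra α ↔
    T ∈ X.toeplitz ∧ X.pencil (homogeneousCoord α) * T = T * X.pencil (homogeneousCoord α) := by
  refine and_congr_right fun _ => ?_
  exact Set.mem_centralizer_iff.trans (by simp only [Set.mem_singleton_iff, forall_eq])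

lemma HasDefect.mem_typeAlgebra_iff (h : X.HasDefect T a a') {α : OnePoint ℂ} :
    T ∈ X.typeAlgebra α ↔ X.IsType (homogeneousCoord α) a a' := by
  rw [CompressedShift.mem_typeAlgebra_iff, h.commute_pencil_iff, and_iff_right ⟨a, a', h⟩]

lemma pencil_mem_typeAlgebra (α : OnePoint ℂ) : X.pencil (homogeneousCoord α) ∈ X.typeAlgebra α :=
  (hasDefect_pencil _).mem_typeAlgebra_iff.mpr (isType_pencil _)

lemma typeAlgebra_mul_comm {α : OnePoint ℂ} (hA : A ∈ X.typeAlgebra α) (hB : B ∈ X.typeAlgebra α) :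
    A * B = B * A := by
  have hAB := mul_mem hA hB
  obtain ⟨⟨_, _, hA'⟩, -⟩ := hA
  obtain ⟨⟨_, _, hB'⟩, -⟩ := hB
  obtain ⟨⟨_, _, hAB'⟩, -⟩ := hAB
  exact hA'.mul_comm hB' hAB'

lemma exists_subset_typeAlgebra {𝒜 : NonUnitalSubalgebra ℂ (K →L[ℂ] K)}
    (h𝒜 : (𝒜 : Set (K →L[ℂ] K)) ⊆ X.toeplitz) :
    ∃ α, (𝒜 : Set (K →L[ℂ] K)) ⊆ X.typeAlgebra α := by
  by_cases h_line : ∀ A ∈ 𝒜, ∀ a a', X.HasDefect A a a' → a ∈ X.line ∧ X.J a' ∈ X.line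
  · refine ⟨OnePoint.infty, fun A hA => ?_⟩
    obtain ⟨a, a', hA'⟩ := h𝒜 hA
    refine hA'.mem_typeAlgebra_iff.mpr ?_
    simpa [IsType, homogeneousCoord] using (h_line A hA a a' hA').1
  push Not at h_line
  obtain ⟨A, hA, a, a', hA', not_line⟩ := h_line
  obtain ⟨α, tA⟩ := exists_isType_of_sq hA' (h𝒜 (mul_mem hA hA))
  refine ⟨α, fun B hB => ?_⟩
  obtain ⟨b, b', hB'⟩ := h𝒜 hB
  exact hB'.mem_typeAlgebra_iff.mpr
    (tA.of_mul hA' hB' (h𝒜 (mul_mem hA hB)) fun h => not_line h.1 h.2)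

lemma maximal_iff (𝒜 : NonUnitalSubalgebra ℂ (K →L[ℂ] K)) :
    Maximal (fun 𝒜' : NonUnitalSubalgebra ℂ (K →L[ℂ] K) =>
      (𝒜' : Set (K →L[ℂ] K)) ⊆ X.toeplitz) 𝒜 ↔
      ∃ α, (𝒜 : Set (K →L[ℂ] K)) = X.typeAlgebra α := by
  constructor
  · intro h
    obtain ⟨α, hα⟩ := exists_subset_typeAlgebra h.prop
    have hle : 𝒜 ≤ (X.typeAlgebra α).toNonUnitalSubalgebra := hα
    exact ⟨α, hα.antisymm (h.le_of_ge (typeAlgebra_subset α) hle)⟩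
  · rintro ⟨α, hα⟩
    refine ⟨hα.trans_subset (typeAlgebra_subset α), fun 𝒜' h𝒜' hle A hA => ?_⟩
    obtain ⟨β, hβ⟩ := exists_subset_typeAlgebra h𝒜'
    have pencil_mem : X.pencil (homogeneousCoord α) ∈ X.typeAlgebra β :=
      hβ (hle (hα.ge (pencil_mem_typeAlgebra α)))
    exact hα.ge (mem_typeAlgebra_iff.mpr ⟨h𝒜' hA, typeAlgebra_mul_comm pencil_mem (hβ hA)⟩)

lemma mem_typeAlgebra_iff_inner {α : OnePoint ℂ} : T ∈ X.typeAlgebra α ↔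
    (∀ f g, ⟪X.k, f⟫_ℂ = 0 → ⟪X.k, g⟫_ℂ = 0 → ⟪g, T f⟫_ℂ = ⟪X.R g, T (X.R f)⟫_ℂ) ∧
    ∀ f g, ⟪(X.pencil (homogeneousCoord α)).adjoint g, T f⟫_ℂ =
      ⟪g, T (X.pencil (homogeneousCoord α) f)⟫_ℂ := by
  rw [mem_typeAlgebra_iff, mem_toeplitz_iff_inner, ContinuousLinearMap.ext_iff]
  refine and_congr_right fun _ => forall_congr' fun f => ?_
  simp only [ContinuousLinearMap.adjoint_inner_left]
  exact (ext_iff_inner_left ℂ).trans Iff.rfl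

lemma isClosed_toCLM_mem_typeAlgebra (α : OnePoint ℂ) :
    IsClosed {T : K →WOT[ℂ] K | T.toCLM ∈ X.typeAlgebra α} := by
  have continuous_inner (f g : K) : Continuous fun T : K →WOT[ℂ] K => ⟪g, T.toCLM f⟫_ℂ :=
    ContinuousLinearMapWOT.continuous_dual_apply f (innerSL ℂ g)
  simp only [mem_typeAlgebra_iff_inner, Set.ofPred_and, Set.ofPred_forall]
  refine IsClosed.inter ?_ ?_
  · exact isClosed_iInter fun f => isClosed_iInter fun g => isClosed_iInter fun _ =>
      isClosed_iInter fun _ => isClosed_eq (continuous_inner _ _) (continuous_inner _ _)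
  · exact isClosed_iInter fun f => isClosed_iInter fun g =>
      isClosed_eq (continuous_inner _ _) (continuous_inner _ _)

lemma mem_typeAlgebra_infty_iff :
    T ∈ X.typeAlgebra OnePoint.infty ↔ ∃ a', X.HasDefect T 0 a' := by
  constructor
  · rintro hT
    obtain ⟨a, a', h⟩ := hT.1
    have ha : a ∈ X.line := by
      simpa [IsType, homogeneousCoord] using h.mem_typeAlgebra_iff.mp hT
    obtain ⟨c, rfl⟩ := Submodule.mem_span_singleton.mp ha
    exact ⟨_, hasDefect_add_smul_k_left.mp (by rwa [zero_add])⟩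
  · rintro ⟨a', h⟩
    exact h.mem_typeAlgebra_iff.mpr (by simp [IsType, homogeneousCoord])

lemma mem_typeAlgebra_coe_iff {α : ℂ} : T ∈ X.typeAlgebra (OnePoint.some α) ↔
    ∃ (a : K) (c : ℂ), X.HasDefect T (a + c • X.k) (conj α • X.J a) := by
  constructor
  · intro hT
    obtain ⟨a, a', h⟩ := hT.1
    have hJ : X.J (α • a - X.J a') ∈ X.line := X.J_mem_line_iff.mpr <| by
      simpa [IsType, homogeneousCoord] using h.mem_typeAlgebra_iff.mp hT
    obtain ⟨c, hc⟩ := Submodule.mem_span_singleton.mp hJ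
    rw [map_sub, map_smulₛₗ, J_J] at hc
    refine ⟨a, conj (⟪X.k, a'⟫_ℂ - c), hasDefect_add_smul_k_left.mpr ?_⟩
    have ha' : conj α • X.J a + (⟪X.k, a'⟫_ℂ - c) • X.k = a' := by
      rw [sub_smul, hc]
      module
    rwa [Complex.conj_conj, ha']
  · rintro ⟨a, c, h⟩
    refine h.mem_typeAlgebra_iff.mpr (Submodule.mem_span_singleton.mpr ⟨α * (c + ⟪X.k, a⟫_ℂ), ?_⟩)
    simp only [homogeneousCoord, map_smulₛₗ, J_J, Complex.conj_conj]
    module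

end CompressedShift

section ModelSpace

variable {u : Linf}

lemma mem_modelSpace_iff {f : L2} : f ∈ modelSpace u ↔ f ∈ H2 ∧ M (star u) f ∈ H2ᗮ := by
  refine and_congr_right fun _ => ⟨fun h y hy => ?_, ?_⟩
  · rw [← inner_M_left]
    exact h _ ⟨y, hy, rfl⟩
  · rintro h _ ⟨y, hy, rfl⟩
    rw [← M_apply, inner_M_left]
    exact h y hy

lemma H2_orthogonal_le : H2ᗮ ≤ (modelSpace u)ᗮ := Submodule.orthogonal_le inf_le_left

lemma M_mem_modelSpace_orthogonal {h : L2} (hh : h ∈ H2) : M u h ∈ (modelSpace u)ᗮ :=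
  fun _ hf => inner_eq_zero_symm.mp (hf.2 _ ⟨h, hh, rfl⟩)

lemma inner_P (f : modelSpace u) (x : L2) : ⟪f, P u x⟫_ℂ = ⟪(f : L2), x⟫_ℂ :=
  Submodule.inner_orthogonalProjectionOnto_eq_of_mem_left f x

lemma inner_P_left (x : L2) (f : modelSpace u) : ⟪P u x, f⟫_ℂ = ⟪x, (f : L2)⟫_ℂ :=
  Submodule.inner_orthogonalProjectionOnto_eq_of_mem_right f x

lemma P_coe (f : modelSpace u) : P u (f : L2) = f :=
  Submodule.orthogonalProjectionOnto_mem_subspace_eq_self f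

lemma coe_P_eq {x y : L2} (hy : y ∈ modelSpace u) (hxy : x - y ∈ (modelSpace u)ᗮ) :
    (P u x : L2) = y :=
  Submodule.eq_starProjection_of_mem_orthogonal hy hxy

variable (u) in
/-- The compressed shift `S_u`. -/
def shift : modelSpace u →L[ℂ] modelSpace u := P u ∘L M z ∘L (modelSpace u).subtypeL

lemma shift_apply (f : modelSpace u) : shift u f = P u (M z f) := rfl

lemma adjoint_shift_apply (f : modelSpace u) : (shift u).adjoint f = P u (M (star z) f) := by
  refine ext_inner_right ℂ fun g => ?_
  rw [ContinuousLinearMap.adjoint_inner_left, shift_apply, inner_P, inner_P_left, inner_M_left,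
    star_star]

lemma M_e_zero_mem_H2 (hu : IsInner u) : M u (e 0) ∈ H2 :=
  mem_H2_iff.mpr fun n hn => by rw [← fourierCoeff_Linf, hu.coeff_eq_zero n hn]

lemma inner_e_M_star (n : ℤ) : ⟪e n, M (star u) (e 0)⟫_ℂ = conj ⟪e (-n), M u (e 0)⟫_ℂ := by
  rw [← inner_e_star, star_M, star_fourierLp, neg_zero]

lemma coe_adjoint_shift (hu : IsInner u) (f : modelSpace u) :
    ((shift u).adjoint f : L2) = M (star z) f - ⟪e 0, (f : L2)⟫_ℂ • e (-1) := by
  obtain ⟨f_mem, star_u_f_mem⟩ := mem_modelSpace_iff.mp f.2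
  have e_mem : e (-1) ∈ H2ᗮ :=
    mem_H2_orthogonal_iff.mpr fun n => by rw [inner_e_e, if_neg (by omega)]
  rw [adjoint_shift_apply]
  refine coe_P_eq (mem_modelSpace_iff.mpr ⟨mem_H2_iff.mpr fun n hn => ?_, ?_⟩) ?_
  · rw [star_z, inner_sub_right, inner_smul_right, inner_e_M_zPow, inner_e_e]
    obtain rfl | hn' := eq_or_ne n (-1)
    · rw [if_pos rfl, mul_one, sub_neg_eq_add, neg_add_cancel, sub_self]
    · rw [if_neg hn', mem_H2_iff.mp f_mem _ (by omega), mul_zero, sub_zero]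
  · refine mem_H2_orthogonal_iff.mpr fun n => ?_
    have e_neg_one : e (-1) = M (zPow (-1)) (e 0) := by rw [M_zPow_e, add_zero]
    rw [e_neg_one, star_z, map_sub, map_smul, M_comm _ (zPow (-1)), M_comm _ (zPow (-1)),
      inner_sub_right, inner_smul_right, inner_e_M_zPow, inner_e_M_zPow, inner_e_M_star,
      mem_H2_iff.mp (M_e_zero_mem_H2 hu) _ (by omega), map_zero, mul_zero, sub_zero]
    exact_mod_cast mem_H2_orthogonal_iff.mp star_u_f_mem (n + 1)
  · rw [sub_sub_cancel]
    exact H2_orthogonal_le (H2ᗮ.smul_mem _ e_mem)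

lemma inner_adjoint_shift_pow (hu : IsInner u) (n : ℕ) (g : modelSpace u) {h : L2} (hh : h ∈ H2) :
    ⟪(((shift u).adjoint ^ n) g : L2), h⟫_ℂ = ⟪(g : L2), M (zPow n) h⟫_ℂ := by
  induction n generalizing h with
  | zero => rw [pow_zero, one_apply_eq_self, Nat.cast_zero, M_zPow_zero]
  | succ n ih =>
    rw [pow_succ', mul_apply_eq_comp, coe_adjoint_shift hu, inner_sub_left, inner_smul_left,
      mem_H2_iff.mp hh _ (by norm_num), mul_zero, sub_zero, inner_M_left, star_star,
      ih (by exact_mod_cast M_zPow_mem_H2 1 hh), Nat.cast_succ, M_zPow_add]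
    rfl

lemma C_eq (f : L2) : C u f = M u (M (star z) (star f)) := by
  rw [← star_M]
  rfl

lemma C_mem (hu : IsInner u) (f : modelSpace u) : C u f ∈ modelSpace u := by
  obtain ⟨f_mem, star_u_f_mem⟩ := mem_modelSpace_iff.mp f.2
  refine mem_modelSpace_iff.mpr ⟨mem_H2_iff.mpr fun n hn => ?_,
    mem_H2_orthogonal_iff.mpr fun n => ?_⟩
  · have hC : C u f = M (zPow (-1)) (star (M (star u) f)) := by
      rw [C_eq, star_z, star_M, star_star, M_comm]
    have star_mem := star_mem_H2_of_mem_orthogonal star_u_f_mem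
    obtain hn' | hn' := lt_or_eq_of_le (Int.add_one_le_of_lt hn)
    · rw [hC, inner_e_M_zPow, mem_H2_iff.mp star_mem _ (by omega)]
    · rw [hC, inner_e_M_zPow, inner_e_star, show -(n - -1) = ((0 : ℕ) : ℤ) by omega,
        mem_H2_orthogonal_iff.mp star_u_f_mem, map_zero]
  · rw [C_eq, M_star_M hu.norm_eq_one, star_z, inner_e_M_zPow, inner_e_star,
      mem_H2_iff.mp f_mem _ (by omega), map_zero]

/-- The conjugation `C` of the model space, as a conjugate-linear map. -/
def conjugation (hu : IsInner u) : modelSpace u →ₗ⋆[ℂ] modelSpace u where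
  toFun f := ⟨C u f, C_mem hu f⟩
  map_add' f g := Subtype.ext <| by
    simp only [Submodule.coe_add, C_eq, star_add_Lp, map_add]
  map_smul' c f := Subtype.ext <| by
    simp only [Submodule.coe_smul, C_eq, star_smul_Lp, map_smul]

lemma coe_conjugation (hu : IsInner u) (f : modelSpace u) :
    (conjugation hu f : L2) = M u (M (star z) (star (f : L2))) := C_eq _

lemma conjugation_conjugation (hu : IsInner u) (f : modelSpace u) :
    conjugation hu (conjugation hu f) = f := Subtype.ext <| by
  rw [coe_conjugation, coe_conjugation, star_M, star_M, star_star, star_star,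
    M_comm (star z) (star u), M_M_star hu.norm_eq_one, M_star_M norm_z]

lemma inner_conjugation_conjugation (hu : IsInner u) (f g : modelSpace u) :
    ⟪conjugation hu f, conjugation hu g⟫_ℂ = ⟪g, f⟫_ℂ := by
  rw [Submodule.coe_inner, coe_conjugation, coe_conjugation, inner_M_left,
    M_star_M hu.norm_eq_one, inner_M_left, M_star_M norm_star_z, inner_star_star]
  rfl

lemma conjugation_shift (hu : IsInner u) (f : modelSpace u) :
    conjugation hu (shift u f) = (shift u).adjoint (conjugation hu f) := by
  refine ext_inner_left ℂ fun g => ?_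
  rw [← conjugation_conjugation hu g, inner_conjugation_conjugation,
    ContinuousLinearMap.adjoint_inner_right, shift_apply, shift_apply, inner_P_left, inner_P_left,
    conjugation_conjugation, coe_conjugation, coe_conjugation, ← inner_star_star, star_M, star_M,
    star_M, star_star, star_star, inner_M_left, star_star]

variable (u) in
/-- The reproducing kernel of the model space at the origin. -/
def kernel : modelSpace u := P u (e 0)

lemma inner_kernel (f : modelSpace u) : ⟪kernel u, f⟫_ℂ = ⟪e 0, (f : L2)⟫_ℂ := inner_P_left _ f

lemma coe_kernel (hu : IsInner u) :
    (kernel u : L2) = e 0 - conj ⟪e 0, M u (e 0)⟫_ℂ • M u (e 0) := by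
  have e_mem : e 0 ∈ H2 := e_mem_H2 0
  refine coe_P_eq (mem_modelSpace_iff.mpr ⟨H2.sub_mem e_mem
    (H2.smul_mem _ (M_e_zero_mem_H2 hu)), mem_H2_orthogonal_iff.mpr fun n => ?_⟩) ?_
  · rw [map_sub, map_smul, M_star_M hu.norm_eq_one, inner_sub_right, inner_smul_right, inner_e_e,
      inner_e_M_star]
    obtain rfl | hn := eq_or_ne n 0
    · rw [Nat.cast_zero, if_pos rfl, neg_zero, mul_one, sub_self]
    · rw [if_neg (by omega), mem_H2_iff.mp (M_e_zero_mem_H2 hu) _ (by omega), map_zero, mul_zero,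
        sub_zero]
  · rw [sub_sub_cancel]
    exact Submodule.smul_mem _ _ (M_mem_modelSpace_orthogonal e_mem)

lemma kernel_ne_zero (hu : IsInner u) (hnc : ¬ IsConstant u) : kernel u ≠ 0 := by
  intro hk
  have e_eq := coe_kernel hu
  rw [hk, Submodule.coe_zero, eq_comm, sub_eq_zero] at e_eq
  set c := conj ⟪e 0, M u (e 0)⟫_ℂ
  have hc : c ≠ 0 := fun hc =>
    orthonormal_fourier.ne_zero 0 (e_eq.trans (by rw [hc, zero_smul]))
  have u_eq : (u : UnitAddCircle → ℂ) =ᵐ[haarAddCircle] Lp.const 2 haarAddCircle c⁻¹ :=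
    ae_eq_iff_M_e_zero_eq.mpr (by rw [const_eq_smul_e, eq_inv_smul_iff₀ hc, ← e_eq])
  exact hnc ⟨c⁻¹, u_eq.trans (Lp.coeFn_const 2 haarAddCircle c⁻¹)⟩

lemma nontrivial_modelSpace (hu : IsInner u) (hnc : ¬ IsConstant u) : Nontrivial (modelSpace u) :=
  nontrivial_of_ne _ _ (kernel_ne_zero hu hnc)

lemma shift_adjoint (hu : IsInner u) (f : modelSpace u) :
    shift u ((shift u).adjoint f) = f - ⟪kernel u, f⟫_ℂ • kernel u := by
  rw [shift_apply, coe_adjoint_shift hu, map_sub, map_smul, M_M_star norm_z, z, M_zPow_e, map_sub,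
    map_smul, P_coe, inner_kernel]
  rfl

lemma adjoint_shift_kernel (hu : IsInner u) :
    (shift u).adjoint (kernel u) = -(conj ⟪e 0, M u (e 0)⟫_ℂ • conjugation hu (kernel u)) := by
  refine Subtype.ext ?_
  rw [coe_adjoint_shift hu, Submodule.coe_neg, Submodule.coe_smul, coe_conjugation, coe_kernel hu]
  set w := ⟪e 0, M u (e 0)⟫_ℂ with hw
  have star_kernel : star (e 0 - conj w • M u (e 0)) = e 0 - w • M (star u) (e 0) := by
    rw [sub_eq_add_neg, ← neg_smul, star_add_Lp, star_smul_Lp, star_M, star_fourierLp, map_neg,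
      Complex.conj_conj, neg_smul, neg_zero, ← sub_eq_add_neg]
  rw [star_kernel, inner_sub_right, inner_smul_right, ← hw, inner_e_e, if_pos rfl]
  simp only [map_sub, map_smul]
  rw [M_comm u (star z), M_comm u (star z), M_M_star hu.norm_eq_one, star_z, M_zPow_e, add_zero]
  module

lemma inner_kernel_adjoint_shift_pow (hu : IsInner u) (n : ℕ) (f : modelSpace u) :
    ⟪kernel u, ((shift u).adjoint ^ n) f⟫_ℂ = ⟪e n, (f : L2)⟫_ℂ := by
  have e_zero_mem : e 0 ∈ H2 := e_mem_H2 0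
  rw [inner_kernel, ← inner_conj_symm, inner_adjoint_shift_pow hu n f e_zero_mem, M_zPow_e,
    add_zero, inner_conj_symm]

/-- The compressed shift on the model space of `u`. -/
def model (hu : IsInner u) : CompressedShift (modelSpace u) where
  S := shift u
  C := conjugation hu
  k := kernel u
  w := ⟪e 0, M u (e 0)⟫_ℂ
  C_C := conjugation_conjugation hu
  inner_C_C := inner_conjugation_conjugation hu
  C_S := conjugation_shift hu
  S_adjoint := shift_adjoint hu
  adjoint_k := adjoint_shift_kernel hu
  hasSum_norm_sq f := by
    simp only [inner_kernel_adjoint_shift_pow hu]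
    exact hasSum_norm_sq_inner_e f.2.1

end ModelSpace

section Symbols

variable {u : Linf}

variable (u) in
/-- The bounded functions in the model space, on which `A_Φ f = P_u (Φ f)` is defined. -/
def boundedVectors : Submodule ℂ (modelSpace u) :=
  (M.flip (e 0)).range.comap (modelSpace u).subtype

lemma mem_boundedVectors_iff {f : modelSpace u} :
    f ∈ boundedVectors u ↔ ∃ a : Linf, M a (e 0) = (f : L2) := Iff.rfl

lemma C_mem_boundedVectors (hu : IsInner u) {f : modelSpace u} (hf : f ∈ boundedVectors u) :
    (model hu).C f ∈ boundedVectors u := by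
  obtain ⟨a, ha⟩ := mem_boundedVectors_iff.mp hf
  refine mem_boundedVectors_iff.mpr
    ⟨(u • (star z • star a : Linf) : Linf), Eq.trans ?_ (coe_conjugation hu f).symm⟩
  rw [M_smul, M_smul, ← ha, star_M, star_fourierLp, neg_zero]

lemma R_mem_boundedVectors (hu : IsInner u) {f : modelSpace u} (hf : f ∈ boundedVectors u) :
    (model hu).R f ∈ boundedVectors u := by
  obtain ⟨a, ha⟩ := mem_boundedVectors_iff.mp hf
  refine mem_boundedVectors_iff.mpr
    ⟨(star z • a : Linf) - ⟪e 0, (f : L2)⟫_ℂ • zPow (-1), Eq.trans ?_ (coe_adjoint_shift hu f).symm⟩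
  rw [map_sub, map_smul, sub_apply, smul_apply, M_smul, ha, M_zPow_e, add_zero]

lemma S_pow_k_mem_boundedVectors (hu : IsInner u) (n : ℕ) :
    ((model hu).S ^ n) (model hu).k ∈ boundedVectors u := by
  induction n with
  | zero =>
    refine mem_boundedVectors_iff.mpr
      ⟨zPow 0 - conj ⟪e 0, M u (e 0)⟫_ℂ • u, Eq.trans ?_ (coe_kernel hu).symm⟩
    rw [map_sub, map_smul, sub_apply, smul_apply, M_zPow_zero]
  | succ n ih =>
    rw [pow_succ', mul_apply_eq_comp, ← CompressedShift.J_C, ← CompressedShift.C_R]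
    exact C_mem_boundedVectors hu (R_mem_boundedVectors hu (C_mem_boundedVectors hu ih))

lemma dense_boundedVectors (hu : IsInner u) : Dense (boundedVectors u : Set (modelSpace u)) := by
  rw [Submodule.dense_iff_topologicalClosure_eq_top, Submodule.topologicalClosure_eq_top_iff,
    Submodule.eq_bot_iff]
  refine fun f hf => (model hu).eq_of_inner_S_pow_k fun n => ?_
  rw [inner_zero_left]
  exact inner_eq_zero_symm.mp (hf _ (S_pow_k_mem_boundedVectors hu n))

lemma hasSymbol_iff (hu : IsInner u) {A : Op u} {Φ : L2} :
    HasSymbol u A Φ ↔ ∀ (f g : modelSpace u) (a b : Linf), M a (e 0) = (f : L2) →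
      M b (e 0) = (g : L2) → ⟪g, A f⟫_ℂ = ⟪M b (e 0), M a Φ⟫_ℂ := by
  constructor
  · intro h f g a b ha hb
    rw [h f a (ae_eq_iff_M_e_zero_eq.mpr ha), inner_P, hb]
    rfl
  · refine fun h f a ha => (dense_boundedVectors hu).eq_of_inner_right ℂ fun g hg => ?_
    obtain ⟨b, hb⟩ := mem_boundedVectors_iff.mp hg
    rw [h f g a b (ae_eq_iff_M_e_zero_eq.mp ha) hb, inner_P, hb]
    rfl

lemma hasSum_inner_k_mul_inner (hu : IsInner u) {φ : L2} (hφ : φ ∈ H2) {f g : modelSpace u}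
    {a b : Linf} (ha : M a (e 0) = (f : L2)) (hb : M b (e 0) = (g : L2)) :
    HasSum (fun j : ℕ => ⟪(model hu).k, ((model hu).R ^ j) f⟫_ℂ * ⟪((model hu).R ^ j) g, P u φ⟫_ℂ)
      ⟪M b (e 0), M a φ⟫_ℂ := by
  have inner_eq : ⟪M b (e 0), M a φ⟫_ℂ = ⟪M b (star φ), (f : L2)⟫_ℂ := by
    rw [← ha, ← inner_M_star, star_star]
  rw [inner_eq]
  convert hasSum_inner_e_of_mem_H2 (M b (star φ)) f.2.1 using 2 with j
  rw [mul_comm]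
  refine congrArg₂ _ ?_ (inner_kernel_adjoint_shift_pow hu j f)
  have M_e : e j = M (zPow j) (e 0) := by rw [M_zPow_e, add_zero]
  rw [inner_P, M_e, ← inner_M_star, star_star, hb]
  exact inner_adjoint_shift_pow hu j g hφ

-- Sarason's theorem. Both sides are read off the same series, because `⟪k, R ^ j f⟫` is the `j`-th
-- Fourier coefficient of `f`.
theorem hasSymbol_iff_hasDefect (hu : IsInner u) {A : Op u} {φ ψ : L2} (hφ : φ ∈ H2)
    (hψ : ψ ∈ H2) :
    HasSymbol u A (φ + star ψ) ↔ (model hu).HasDefect A (P u φ) (P u ψ) := by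
  have hasSum {f g : modelSpace u} {a b : Linf} (ha : M a (e 0) = (f : L2))
      (hb : M b (e 0) = (g : L2)) : HasSum (fun j : ℕ =>
        ⟪(model hu).k, ((model hu).R ^ j) f⟫_ℂ * ⟪((model hu).R ^ j) g, P u φ⟫_ℂ +
        ⟪P u ψ, ((model hu).R ^ j) f⟫_ℂ * ⟪((model hu).R ^ j) g, (model hu).k⟫_ℂ)
      ⟪M b (e 0), M a (φ + star ψ)⟫_ℂ := by
    rw [map_add, inner_add_right, inner_M_star, ← inner_conj_symm (M b ψ)]
    refine (hasSum_inner_k_mul_inner hu hφ ha hb).add ?_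
    convert Complex.hasSum_conj'.mpr (hasSum_inner_k_mul_inner hu hψ hb ha) using 2 with j
    rw [map_mul, mul_comm]
    exact congrArg₂ _ (inner_conj_symm _ (model hu).k).symm (inner_conj_symm (P u ψ) _).symm
  rw [hasSymbol_iff hu]
  constructor
  · refine fun h => CompressedShift.hasDefect_of_hasSum (dense_boundedVectors hu)
      (fun _ => R_mem_boundedVectors hu) fun f hf g hg => ?_
    obtain ⟨a, ha⟩ := mem_boundedVectors_iff.mp hf
    obtain ⟨b, hb⟩ := mem_boundedVectors_iff.mp hg
    rw [h f g a b ha hb]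
    exact hasSum ha hb
  · exact fun h f g a b ha hb =>
      tendsto_nhds_unique (h.tendsto_sum f g) (hasSum ha hb).tendsto_sum_nat

lemma boundedTTO_eq (hu : IsInner u) : boundedTTO u = (model hu).toeplitz := by
  ext A
  constructor
  · rintro ⟨Φ, hΦ⟩
    obtain ⟨φ, hφ, ψ, hψ, rfl⟩ := exists_analytic_add_antianalytic Φ
    exact ⟨_, _, (hasSymbol_iff_hasDefect hu hφ hψ).mp hΦ⟩
  · rintro ⟨a, a', h⟩
    refine ⟨(a : L2) + star (a' : L2), (hasSymbol_iff_hasDefect hu a.2.1 a'.2.1).mpr ?_⟩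
    rwa [P_coe, P_coe]

lemma typeSet_eq (hu : IsInner u) [Nontrivial (modelSpace u)] (α : OnePoint ℂ) :
    typeSet u α = (model hu).typeAlgebra α := by
  ext A
  cases α with
  | infty =>
    refine Iff.trans ?_ CompressedShift.mem_typeAlgebra_infty_iff.symm
    constructor
    · rintro ⟨ψ, hψ, h⟩
      refine ⟨P u ψ, ?_⟩
      rw [← map_zero (P u), ← hasSymbol_iff_hasDefect hu H2.zero_mem hψ, zero_add]
      exact h
    · rintro ⟨a', h⟩
      refine ⟨a', a'.2.1, ?_⟩
      rwa [← zero_add (star (a' : L2)), hasSymbol_iff_hasDefect hu H2.zero_mem a'.2.1, map_zero,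
        P_coe]
  | coe α =>
    refine Iff.trans (exists₂_congr fun φ c => ?_) CompressedShift.mem_typeAlgebra_coe_iff.symm
    have symbol_eq : (φ : L2) + α • star (SC u φ : L2) + Lp.const 2 haarAddCircle c =
        ((φ : L2) + c • e 0) + star ((conj α • SC u φ : modelSpace u) : L2) := by
      rw [Submodule.coe_smul, star_smul_Lp, Complex.conj_conj, const_eq_smul_e, add_right_comm]
    have analytic_mem : (φ : L2) + c • e 0 ∈ H2 :=
      H2.add_mem φ.2.1 (H2.smul_mem c (e_mem_H2 0))
    rw [symbol_eq, hasSymbol_iff_hasDefect hu analytic_mem (conj α • SC u φ).2.1, map_add, map_smul,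
      P_coe, P_coe]
    rfl

end Symbols

end TTO

end

theorem mainTheorem2 (u : TTO.Linf) (hu : TTO.IsInner u) (hnc : ¬ TTO.IsConstant u) :
    -- each `B_α` is a commutative, weakly closed algebra of bounded truncated Toeplitz operators
    (∀ α : OnePoint ℂ, ∃ B : Subalgebra ℂ (TTO.Op u),
      (B : Set (TTO.Op u)) = TTO.typeSet u α ∧
      (B : Set (TTO.Op u)) ⊆ TTO.boundedTTO u ∧
      (∀ A ∈ B, ∀ A' ∈ B, A * A' = A' * A) ∧
      IsClosed {T : TTO.modelSpace u →WOT[ℂ] TTO.modelSpace u | T.toCLM ∈ B}) ∧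
    -- every algebra of bounded truncated Toeplitz operators lies in some `B_α`
    (∀ 𝒜 : NonUnitalSubalgebra ℂ (TTO.Op u), (𝒜 : Set (TTO.Op u)) ⊆ TTO.boundedTTO u →
      ∃ α : OnePoint ℂ, (𝒜 : Set (TTO.Op u)) ⊆ TTO.typeSet u α) ∧
    -- the `B_α` are exactly the maximal algebras of bounded truncated Toeplitz operators
    (∀ 𝒜 : NonUnitalSubalgebra ℂ (TTO.Op u),
      Maximal (fun 𝒜' : NonUnitalSubalgebra ℂ (TTO.Op u) =>
        (𝒜' : Set (TTO.Op u)) ⊆ TTO.boundedTTO u) 𝒜 ↔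
      ∃ α : OnePoint ℂ, (𝒜 : Set (TTO.Op u)) = TTO.typeSet u α) := by
  have := TTO.nontrivial_modelSpace hu hnc
  simp only [TTO.boundedTTO_eq hu, TTO.typeSet_eq hu]
  refine ⟨fun α => ⟨(TTO.model hu).typeAlgebra α, rfl, TTO.CompressedShift.typeAlgebra_subset α,
    fun _ hA _ hB => TTO.CompressedShift.typeAlgebra_mul_comm hA hB,
    TTO.CompressedShift.isClosed_toCLM_mem_typeAlgebra α⟩,
    fun _ => TTO.CompressedShift.exists_subset_typeAlgebra, TTO.CompressedShift.maximal_iff⟩
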